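/- Let $k\ge 1$ and let $V$ be a finite set with $|V|=n\ge 2k$. Write $V^{(k)}$ for the set of $k$-element subsets of $V$. A weighted $k$-uniform hypergraph on $V$ is a function $w:V^{(k)}\to\mathbb R$; put $w(V)=\sum_{e\in V^{(k)}}w(e)$, $d(w)=w(V)/\binom nk$, $\langle w,u\rangle=\sum_{e\in V^{(k)}}w(e)u(e)$, and for a permutation $\pi$ of $V$ let $w_\pi(e)=w(\pi^{-1}e)$. The discrepancy of a pair is $$\mathrm{disc}(w,u)=\max_{\pi\in S(V)}\Bigl|\langle w_\pi,u\rangle-d(w)d(u)\binom nk\Bigr|.$$ Fix distinct vertices $x_1,y_1,\dots,x_k,y_k$ of $V$. For $0\le i\le k$ define $\phi_i:V^{(k)}\to\mathbb R$ by $\phi_i(A)=(-1)^{|A\cap\{y_1,\dots,y_i\}|}$ if $|A\cap\{x_j,y_j\}|=1$ for all $1\le j\le i$, and $\phi_i(A)=0$ otherwise, and let $V_i\subseteq\mathbb R^{V^{(k)}}$ be the linear span of $\{(\phi_i)_\pi:\pi\in S(V)\}$ (this does not depend on the choice of the vertices $x_j,y_j$). Let $u_1,\dots,u_k$ be nonzero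 weighted $k$-uniform hypergraphs on $V$. If $u_i(V)=0$ for all $i$ and $\mathrm{disc}(u_i,u_j)=0$ for all $1\le i<j\le k$, then there is a permutation $\sigma$ of $\{1,\dots,k\}$ such that $u_{\sigma(i)}\in V_i$ for every $1\le i\le k$. Conversely, if there is such a permutation $\sigma$, then $u_i(V)=0$ for all $i$ and $\mathrm{disc}(u_i,u_j)=0$ for all $1\le i<j\le k$. -/

import Mathlib

open scoped Pointwise

noncomputable section

/-- A weighted `k`-uniform hypergraph with vertex set `V`: a real weight on each `k`-subset. -/
abbrev WeightedHypergraph (V : Type*) (k : ℕ) : Type _ := Set.powersetCard V k → ℝ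

namespace WeightedHypergraph

variable {V : Type*} [Fintype V] [DecidableEq V] {k : ℕ}

/-- The total weight `w(V)`. -/
def total (w : WeightedHypergraph V k) : ℝ := ∑ e, w e

/-- The density `d(w) = w(V) / (n choose k)`, where `n = |V|`. -/
def density (w : WeightedHypergraph V k) : ℝ :=
  w.total / ((Fintype.card V).choose k : ℝ)

/-- The intersection `⟨w, u⟩`. -/
def inter (w u : WeightedHypergraph V k) : ℝ := ∑ e, w e * u e

/-- The action of a permutation of `V` on weighted hypergraphs: `w_π(e) = w(π⁻¹ e)`. -/
def permute (π : Equiv.Perm V) (w : WeightedHypergraph V k) : WeightedHypergraph V k :=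
  fun e => w (π⁻¹ • e)

/-- The discrepancy of a pair:
`disc(w, u) = max_π |⟨w_π, u⟩ - d(w) d(u) (n choose k)|`. -/
def disc (w u : WeightedHypergraph V k) : ℝ :=
  Finset.univ.sup' Finset.univ_nonempty fun π : Equiv.Perm V =>
    |inter (permute π w) u - w.density * u.density * ((Fintype.card V).choose k : ℝ)|

/-- The weighting `φ_i` attached to a sequence of `2k` distinct vertices
`x_1, y_1, …, x_k, y_k`, where `x_{j+1} = s (inl j)` and `y_{j+1} = s (inr j)`:
`φ_i(A) = (-1)^|A ∩ {y_1, …, y_i}|` if `A` contains exactly one of `x_j, y_j` for each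
`1 ≤ j ≤ i`, and `φ_i(A) = 0` otherwise. -/
def phi (s : Fin k ⊕ Fin k ↪ V) (i : Fin (k + 1)) : WeightedHypergraph V k := fun A =>
  if ∀ j : Fin k, (j : ℕ) < i → ((A : Finset V) ∩ {s (Sum.inl j), s (Sum.inr j)}).card = 1 then
    (-1) ^ ((A : Finset V) ∩
      (Finset.univ.filter fun j : Fin k => (j : ℕ) < i).image fun j => s (Sum.inr j)).card
  else 0

/-- The subspace `V_i`: the linear span of all the images of `φ_i` under permutations of `V`. -/
def phiSpan (s : Fin k ⊕ Fin k ↪ V) (i : Fin (k + 1)) : Submodule ℝ (WeightedHypergraph V k) :=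
  Submodule.span ℝ (Set.range fun π : Equiv.Perm V => permute π (phi s i))

end WeightedHypergraph

end

open scoped Pointwise

set_option linter.unusedSectionVars false

namespace WeightedHypergraph

variable {V : Type*} [DecidableEq V] {k : ℕ}

/-! ### Permutation action and orbit spans -/

section Permute

/-! For weightings of total zero, vanishing discrepancy means that the orbit spans are orthogonal.
Three facts control invariant subspaces: a nonzero one contains some φ_i (`exists_phi_mem`); one not
orthogonal to φ_i contains it (`phi_mem_of_inter_ne_zero`); and distinct V_i are orthogonal
(`inter_eq_zero_of_mem_phiSpan`). The first two rest on φ_i being, up to scalars, the only weighting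
alternating in its i pairs and symmetric in the other vertices.

The orbit span of each u_m omits φ_0 = 1, since the total is zero, so it contains one of φ_1, …,
φ_k. Orthogonal spans cannot share one, so by counting each contains exactly one φ_i, and
`mem_phiSpan_of_phi_notMem` puts u_m in V_i. The converse is the orthogonality of the V_i. -/

theorem mem_inv_smul_iff (π : Equiv.Perm V) (A : Set.powersetCard V k) (a : V) :
    a ∈ ((π⁻¹ • A : Set.powersetCard V k) : Finset V) ↔ π a ∈ (A : Finset V) := by
  rw [Set.powersetCard.coe_smul, Finset.mem_inv_smul_finset_iff, Equiv.Perm.smul_def]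

theorem permute_mul (π ρ : Equiv.Perm V) (w : WeightedHypergraph V k) :
    permute (π * ρ) w = permute π (permute ρ w) := by
  funext e
  simp [permute, mul_smul]

@[simp] theorem permute_one (w : WeightedHypergraph V k) : permute 1 w = w := by
  funext e
  simp [permute]

@[simp] theorem permute_neg (π : Equiv.Perm V) (w : WeightedHypergraph V k) :
    permute π (-w) = -permute π w := rfl

@[simp] theorem permute_zero (π : Equiv.Perm V) :
    permute π (0 : WeightedHypergraph V k) = 0 := rfl

theorem permute_add (π : Equiv.Perm V) (w u : WeightedHypergraph V k) :
    permute π (w + u) = permute π w + permute π u := rfl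

theorem permute_sub (π : Equiv.Perm V) (w u : WeightedHypergraph V k) :
    permute π (w - u) = permute π w - permute π u := rfl

theorem permute_smul (π : Equiv.Perm V) (c : ℝ) (w : WeightedHypergraph V k) :
    permute π (c • w) = c • permute π w := rfl

theorem permute_injective (π : Equiv.Perm V) :
    Function.Injective (permute π : WeightedHypergraph V k → WeightedHypergraph V k) := by
  intro w u h
  simpa [← permute_mul] using congrArg (permute π⁻¹) h

/-- A subspace is permutation invariant if it is closed under all vertex permutations. -/
def PermInvariant (W : Submodule ℝ (WeightedHypergraph V k)) : Prop :=
  ∀ π : Equiv.Perm V, ∀ w ∈ W, permute π w ∈ W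

/-- The span of the orbit of `w` under vertex permutations. -/
def orbitSpan (w : WeightedHypergraph V k) : Submodule ℝ (WeightedHypergraph V k) :=
  Submodule.span ℝ (Set.range fun π : Equiv.Perm V => permute π w)

theorem permute_mem_orbitSpan (π : Equiv.Perm V) (w : WeightedHypergraph V k) :
    permute π w ∈ orbitSpan w := Submodule.subset_span ⟨π, rfl⟩

theorem self_mem_orbitSpan (w : WeightedHypergraph V k) : w ∈ orbitSpan w := by
  simpa using permute_mem_orbitSpan 1 w

theorem permInvariant_orbitSpan (w : WeightedHypergraph V k) : PermInvariant (orbitSpan w) := by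
  intro π v hv
  induction hv using Submodule.span_induction with
  | mem x hx =>
    obtain ⟨ρ, rfl⟩ := hx
    simpa [← permute_mul] using permute_mem_orbitSpan (π * ρ) w
  | zero => simp
  | add x y _ _ hx hy => rw [permute_add]; exact add_mem hx hy
  | smul c x _ hx => rw [permute_smul]; exact Submodule.smul_mem _ c hx

end Permute

/-! ### The invariant inner product -/

section Inter

variable [Fintype V]

theorem inter_comm (w u : WeightedHypergraph V k) : inter w u = inter u w := by
  simp [inter, mul_comm]

@[simp] theorem inter_zero_left (u : WeightedHypergraph V k) : inter 0 u = 0 := by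
  simp [inter]

theorem inter_add_left (w v u : WeightedHypergraph V k) :
    inter (w + v) u = inter w u + inter v u := by
  simp [inter, add_mul, Finset.sum_add_distrib]

theorem inter_neg_left (w u : WeightedHypergraph V k) : inter (-w) u = -inter w u := by
  simp [inter]

theorem inter_smul_left (c : ℝ) (w u : WeightedHypergraph V k) :
    inter (c • w) u = c * inter w u := by
  simp [inter, Finset.mul_sum, mul_assoc]

theorem inter_self_eq_zero {w : WeightedHypergraph V k} : inter w w = 0 ↔ w = 0 := by
  constructor
  · intro h
    funext e
    have := (Finset.sum_eq_zero_iff_of_nonneg (fun e _ => mul_self_nonneg (w e))).1 h e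
      (Finset.mem_univ e)
    simpa using this
  · rintro rfl
    simp

theorem inter_permute_permute (π : Equiv.Perm V) (w u : WeightedHypergraph V k) :
    inter (permute π w) (permute π u) = inter w u :=
  Equiv.sum_comp (MulAction.toPerm π⁻¹) fun e => w e * u e

theorem inter_permute_left (π : Equiv.Perm V) (w u : WeightedHypergraph V k) :
    inter (permute π w) u = inter w (permute π⁻¹ u) := by
  rw [← inter_permute_permute π w, ← permute_mul]
  simp

theorem inter_eq_zero_of_mem_orbitSpan {w u v : WeightedHypergraph V k}
    (h : ∀ π : Equiv.Perm V, inter (permute π w) u = 0) (hv : v ∈ orbitSpan w) :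
    inter v u = 0 := by
  induction hv using Submodule.span_induction with
  | mem x hx => obtain ⟨π, rfl⟩ := hx; exact h π
  | zero => simp
  | add x y _ _ hx hy => rw [inter_add_left, hx, hy, add_zero]
  | smul c x _ hx => rw [inter_smul_left, hx, mul_zero]

theorem inter_eq_zero_of_mem_orbitSpan_of_mem_orbitSpan {w u v x : WeightedHypergraph V k}
    (h : ∀ π : Equiv.Perm V, inter (permute π w) u = 0) (hv : v ∈ orbitSpan w)
    (hx : x ∈ orbitSpan u) : inter v x = 0 := by
  rw [inter_comm]
  refine inter_eq_zero_of_mem_orbitSpan (fun π => ?_) hx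
  rw [inter_permute_left, inter_comm]
  exact inter_eq_zero_of_mem_orbitSpan h (permInvariant_orbitSpan w _ _ hv)

/-- Orthogonal decomposition of a weighted hypergraph with respect to a subspace. -/
theorem exists_mem_add_orthogonal (W : Submodule ℝ (WeightedHypergraph V k))
    (u : WeightedHypergraph V k) :
    ∃ w ∈ W, ∃ p : WeightedHypergraph V k, (∀ v ∈ W, inter v p = 0) ∧ u = w + p := by
  -- The plain function space has no inner product structure, so the projection is done in Euclidean
  -- space.
  let L := WithLp.linearEquiv 2 ℝ (WeightedHypergraph V k)
  obtain ⟨y, hy, z, hz, hyz⟩ :=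
    Submodule.exists_add_mem_mem_orthogonal
      (E := EuclideanSpace ℝ (Set.powersetCard V k)) (K := W.comap L.toLinearMap) (L.symm u)
  refine ⟨L y, hy, L z, fun v hv => ?_, ?_⟩
  · have := hz (L.symm v) (by simpa using hv)
    rw [← this, PiLp.inner_apply]
    exact Finset.sum_congr rfl fun e _ => mul_comm _ _
  · rw [← map_add, ← hyz, LinearEquiv.apply_symm_apply]

end Inter

/-! ### Symmetries characterising φ_i -/

section Phi

variable (s : Fin k ⊕ Fin k ↪ V)

/-- The indicator of membership of a vertex in an edge. -/
def vertexIndicator (a : V) (A : Set.powersetCard V k) : ℝ :=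
  if a ∈ (A : Finset V) then 1 else 0

theorem vertexIndicator_inv_smul (π : Equiv.Perm V) (a : V) (A : Set.powersetCard V k) :
    vertexIndicator a (π⁻¹ • A) = vertexIndicator (π a) A := by
  simp only [vertexIndicator, mem_inv_smul_iff]

/-- In product form a vertex permutation acts factor by factor, so the symmetries of φ_i can be read
off. -/
theorem phi_apply_eq_prod (i : Fin (k + 1)) (A : Set.powersetCard V k) :
    phi s i A = ∏ j ∈ Finset.univ.filter (fun j : Fin k => (j : ℕ) < i),
      (vertexIndicator (s (Sum.inl j)) A - vertexIndicator (s (Sum.inr j)) A) := by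
  have hpair : ∀ j : Fin k,
      ((A : Finset V) ∩ {s (Sum.inl j), s (Sum.inr j)}).card = 1 ↔
        (s (Sum.inl j) ∈ (A : Finset V) ↔ s (Sum.inr j) ∉ (A : Finset V)) := by
    intro j
    have hne : s (Sum.inl j) ≠ s (Sum.inr j) := by simp
    by_cases hx : s (Sum.inl j) ∈ (A : Finset V) <;> by_cases hy : s (Sum.inr j) ∈ (A : Finset V)
    · simp [Finset.inter_insert_of_mem hx, Finset.inter_singleton_of_mem hy, hx, hy,
        Finset.card_pair hne]
    · simp [Finset.inter_insert_of_mem hx, Finset.inter_singleton_of_notMem hy, hx, hy]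
    · simp [Finset.inter_insert_of_notMem hx, Finset.inter_singleton_of_mem hy, hx, hy]
    · simp [Finset.inter_insert_of_notMem hx, Finset.inter_singleton_of_notMem hy, hx, hy]
  rw [phi]
  split_ifs with h
  · have hfac : ∀ j ∈ Finset.univ.filter (fun j : Fin k => (j : ℕ) < i),
        vertexIndicator (s (Sum.inl j)) A - vertexIndicator (s (Sum.inr j)) A =
          if s (Sum.inr j) ∈ (A : Finset V) then -1 else 1 := by
      intro j hj
      have := (hpair j).1 (h j (Finset.mem_filter.1 hj).2)
      by_cases hy : s (Sum.inr j) ∈ (A : Finset V) <;> simp [vertexIndicator, this, hy]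
    rw [Finset.prod_congr rfl hfac, Finset.prod_ite]
    simp only [Finset.prod_const, one_pow, mul_one]
    congr 1
    rw [← Finset.card_image_of_injective
      (Finset.filter (fun j => s (Sum.inr j) ∈ (A : Finset V)) _)
      (s.injective.comp Sum.inr_injective)]
    congr 1
    ext a
    simp only [Finset.mem_inter, Finset.mem_image, Finset.mem_filter, Finset.mem_univ, true_and,
      Function.comp_apply]
    constructor
    · rintro ⟨ha, j, hj, rfl⟩
      exact ⟨j, ⟨hj, ha⟩, rfl⟩
    · rintro ⟨j, ⟨hj, ha⟩, rfl⟩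
      exact ⟨ha, j, hj, rfl⟩
  · push Not at h
    obtain ⟨j, hj, hA⟩ := h
    refine (Finset.prod_eq_zero (Finset.mem_filter.2 ⟨Finset.mem_univ j, hj⟩) ?_).symm
    rw [Ne, hpair] at hA
    by_cases hx : s (Sum.inl j) ∈ (A : Finset V) <;>
      by_cases hy : s (Sum.inr j) ∈ (A : Finset V) <;> simp_all [vertexIndicator]

/-- Alternating under the exchange of `x_j` and `y_j` for each `j < i`. -/
def PairAlternating (i : ℕ) (w : WeightedHypergraph V k) : Prop :=
  ∀ j : Fin k, (j : ℕ) < i →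
    permute (Equiv.swap (s (Sum.inl j)) (s (Sum.inr j))) w = -w

/-- The vertex `a` lies outside the first `i` pairs. -/
def OutsidePairs (i : ℕ) (a : V) : Prop :=
  ∀ j : Fin k, (j : ℕ) < i → a ≠ s (Sum.inl j) ∧ a ≠ s (Sum.inr j)

/-- Symmetric in the vertices outside the first `i` pairs. -/
def OutsideSymmetric (i : ℕ) (w : WeightedHypergraph V k) : Prop :=
  ∀ a b : V, OutsidePairs s i a → OutsidePairs s i b → permute (Equiv.swap a b) w = w

theorem pairAlternating_phi (i : Fin (k + 1)) : PairAlternating s i (phi s i) := by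
  intro j hj
  funext A
  have hmem : j ∈ Finset.univ.filter (fun j : Fin k => (j : ℕ) < i) := by simpa using hj
  simp only [permute, phi_apply_eq_prod, Pi.neg_apply, vertexIndicator_inv_smul]
  rw [← Finset.mul_prod_erase _ _ hmem, ← Finset.mul_prod_erase _ _ hmem, ← neg_mul]
  congr 1
  · simp
  · refine Finset.prod_congr rfl fun l hl => ?_
    have hlj : l ≠ j := (Finset.mem_erase.1 hl).1
    rw [Equiv.swap_apply_of_ne_of_ne (by simpa using hlj) (by simp),
      Equiv.swap_apply_of_ne_of_ne (by simp) (by simpa using hlj)]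

theorem outsideSymmetric_phi (i : Fin (k + 1)) : OutsideSymmetric s i (phi s i) := by
  intro a b ha hb
  funext A
  simp only [permute, phi_apply_eq_prod, vertexIndicator_inv_smul]
  refine Finset.prod_congr rfl fun l hl => ?_
  have hl := (Finset.mem_filter.1 hl).2
  rw [Equiv.swap_apply_of_ne_of_ne (ha l hl).1.symm (hb l hl).1.symm,
    Equiv.swap_apply_of_ne_of_ne (ha l hl).2.symm (hb l hl).2.symm]

/-- The edge `{x_1, …, x_k}`. -/
def baseEdge : Set.powersetCard V k :=
  Set.powersetCard.ofCard (s := Finset.univ.map ((⟨Sum.inl, Sum.inl_injective⟩ :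
    Fin k ↪ Fin k ⊕ Fin k).trans s)) (by simp)

theorem mem_baseEdge {a : V} :
    a ∈ (baseEdge s : Finset V) ↔ ∃ j : Fin k, s (Sum.inl j) = a := by
  simp [baseEdge]

theorem phi_baseEdge (i : Fin (k + 1)) : phi s i (baseEdge s) = 1 := by
  rw [phi_apply_eq_prod]
  exact Finset.prod_eq_one fun j _ => by simp [vertexIndicator, mem_baseEdge]

theorem phi_ne_zero (i : Fin (k + 1)) : phi s i ≠ 0 := fun h => by
  simpa [h] using phi_baseEdge s i

theorem phi_zero : phi s 0 = 1 := by
  funext A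
  simp [phi_apply_eq_prod]

theorem eq_of_forall_mem_imp {A B : Set.powersetCard V k}
    (h : ∀ a ∈ (A : Finset V), a ∈ (B : Finset V)) : A = B :=
  Set.powersetCard.eq_iff_subset.2 h

theorem swap_inv_smul_sdiff_card_lt {A B : Set.powersetCard V k} {a b : V}
    (ha : a ∈ (A : Finset V)) (haB : a ∉ (B : Finset V)) (hb : b ∉ (A : Finset V))
    (hbB : b ∈ (B : Finset V)) :
    ((((Equiv.swap a b)⁻¹ • A : Set.powersetCard V k) : Finset V) \ (B : Finset V)).card <
      ((A : Finset V) \ (B : Finset V)).card := by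
  refine Finset.card_lt_card ((Finset.ssubset_iff_of_subset ?_).2 ⟨a, by simp [ha, haB], ?_⟩)
  · intro c hc
    rw [Finset.mem_sdiff, mem_inv_smul_iff] at hc
    rw [Finset.mem_sdiff]
    refine ⟨?_, hc.2⟩
    have hcb : c ≠ b := fun h => hc.2 (h ▸ hbB)
    by_cases hca : c = a
    · exact hca ▸ ha
    · simpa [Equiv.swap_apply_of_ne_of_ne hca hcb] using hc.1
  · rw [Finset.mem_sdiff, mem_inv_smul_iff]
    simp [hb]

/-- Induction on the distance from A to the base edge. If A meets some pair in 0 or 2 vertices, the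
swap of that pair fixes A and alternation gives w A = 0. Otherwise trading some y_j for x_j, or
exchanging two outside vertices, brings A closer. For i = k no outside exchange occurs, so symmetry
is asked only when i < k. -/
theorem eq_zero_of_symmetries {i : ℕ} {w : WeightedHypergraph V k}
    (halt : PairAlternating s i w) (hsym : i < k → OutsideSymmetric s i w)
    (h0 : w (baseEdge s) = 0) : w = 0 := by
  have key : ∀ (n : ℕ) (A : Set.powersetCard V k),
      ((A : Finset V) \ (baseEdge s : Finset V)).card = n → w A = 0 := by
    intro n
    induction n using Nat.strong_induction_on with
    | _ n ih =>
      intro A hA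
      by_cases hgood : ∀ j : Fin k, (j : ℕ) < i →
          (s (Sum.inl j) ∈ (A : Finset V) ↔ s (Sum.inr j) ∉ (A : Finset V))
      · by_cases hy : ∃ j : Fin k, (j : ℕ) < i ∧ s (Sum.inr j) ∈ (A : Finset V)
        · obtain ⟨j, hj, hyA⟩ := hy
          have hxA : s (Sum.inl j) ∉ (A : Finset V) := fun h => (hgood j hj).1 h hyA
          have hlt := swap_inv_smul_sdiff_card_lt (B := baseEdge s) hyA (by simp [mem_baseEdge])
            hxA (by simp [mem_baseEdge])
          have h1 := ih _ (hA ▸ hlt) _ rfl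
          have h2 := congrFun (halt j hj) A
          rw [permute, Equiv.swap_comm, h1] at h2
          simpa using h2.symm
        · push Not at hy
          by_cases hAB : A = baseEdge s
          · rw [hAB, h0]
          · obtain ⟨a, ha, haB⟩ : ∃ a ∈ (A : Finset V), a ∉ (baseEdge s : Finset V) := by
              by_contra! h
              exact hAB (eq_of_forall_mem_imp h)
            obtain ⟨b, hbB, hb⟩ : ∃ b ∈ (baseEdge s : Finset V), b ∉ (A : Finset V) := by
              by_contra! h
              exact hAB (eq_of_forall_mem_imp h).symm
            have haO : OutsidePairs s i a := fun j hj =>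
              ⟨fun h => haB (by simp [mem_baseEdge, h]), fun h => hy j hj (h ▸ ha)⟩
            have hbO : OutsidePairs s i b := fun j hj =>
              ⟨fun h => hb (h ▸ (hgood j hj).2 (hy j hj)), fun h => by
                simp [mem_baseEdge, h] at hbB⟩
            obtain ⟨l, rfl⟩ := (mem_baseEdge s).1 hbB
            have hik : i < k := by
              by_contra! hki
              exact (hbO l (l.2.trans_le hki)).1 rfl
            have hlt := swap_inv_smul_sdiff_card_lt ha haB hb hbB
            rw [← congrFun (hsym hik a _ haO hbO) A]
            exact ih _ (hA ▸ hlt) _ rfl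
      · push Not at hgood
        obtain ⟨j, hj, hbad⟩ := hgood
        have hfix : (Equiv.swap (s (Sum.inl j)) (s (Sum.inr j)))⁻¹ • A = A := by
          refine eq_of_forall_mem_imp fun c hc => ?_
          rw [mem_inv_smul_iff, Equiv.swap_apply_def] at hc
          split_ifs at hc with h1 h2
          · rw [h1]; tauto
          · rw [h2]; tauto
          · exact hc
        have h2 := congrFun (halt j hj) A
        rw [permute, hfix, Pi.neg_apply] at h2
        linarith
  funext A
  exact key _ A rfl

theorem eq_smul_phi_of_symmetries (i : Fin (k + 1)) {w : WeightedHypergraph V k}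
    (halt : PairAlternating s i w) (hsym : (i : ℕ) < k → OutsideSymmetric s i w) :
    w = w (baseEdge s) • phi s i := by
  rw [← sub_eq_zero]
  refine eq_zero_of_symmetries s (i := i) (fun j hj => ?_) (fun hik a b ha hb => ?_) ?_
  · rw [permute_sub, permute_smul, halt j hj, pairAlternating_phi s i j hj, smul_neg]
    abel
  · rw [permute_sub, permute_smul, hsym hik a b ha hb, outsideSymmetric_phi s i a b ha hb]
  · simp [phi_baseEdge]

/-- A nonzero invariant subspace contains one of the weightings `φ_i`. -/
theorem exists_phi_mem {W : Submodule ℝ (WeightedHypergraph V k)} (hW : PermInvariant W)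
    {u : WeightedHypergraph V k} (hu : u ∈ W) (hu0 : u ≠ 0) :
    ∃ i : Fin (k + 1), phi s i ∈ W := by
  classical
  -- Take the largest i admitting a nonzero pair-alternating v in W; maximality will force v to be
  -- symmetric outside the pairs.
  let P : ℕ → Prop := fun i => ∃ v ∈ W, v ≠ 0 ∧ PairAlternating s i v
  have hP0 : P 0 := ⟨u, hu, hu0, fun j hj => absurd hj (Nat.not_lt_zero _)⟩
  obtain ⟨v, hv, hv0, halt⟩ : P (Nat.findGreatest P k) := Nat.findGreatest_spec (Nat.zero_le k) hP0
  have hmax : ∀ m, Nat.findGreatest P k < m → m ≤ k → ¬ P m := fun m h1 h2 =>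
    Nat.findGreatest_is_greatest h1 h2
  have hle : Nat.findGreatest P k ≤ k := Nat.findGreatest_le k
  generalize Nat.findGreatest P k = i at halt hmax hle
  refine ⟨⟨i, Nat.lt_succ_of_le hle⟩, ?_⟩
  have hsym : i < k → OutsideSymmetric s i v := by
    intro hik a b ha hb
    by_cases hab : a = b
    · rw [hab, Equiv.swap_self]
      exact permute_one v
    let l : Fin k := ⟨i, hik⟩
    set x := s (Sum.inl l) with hx
    set y := s (Sum.inr l) with hy
    have hxy : x ≠ y := by simp [hx, hy]
    -- g carries a, b to the next pair x, y and fixes the first i pairs.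
    let g : Equiv.Perm V := Equiv.swap y (Equiv.swap x a b) * Equiv.swap x a
    have hga : g a = x := by
      have : x ≠ Equiv.swap x a b := by
        intro h
        apply hab
        apply (Equiv.swap x a).injective
        rw [← h, Equiv.swap_apply_right]
      simp [g, Equiv.swap_apply_of_ne_of_ne hxy this]
    have hgb : g b = y := by simp [g]
    have hfix : ∀ c, c ≠ x → c ≠ y → c ≠ a → c ≠ b → g c = c := by
      intro c hcx hcy hca hcb
      have : c ≠ Equiv.swap x a b := by
        intro h
        apply hcb
        apply (Equiv.swap x a).injective
        rw [← h, Equiv.swap_apply_of_ne_of_ne hcx hca]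
      simp [g, Equiv.swap_apply_of_ne_of_ne hcx hca, Equiv.swap_apply_of_ne_of_ne hcy this]
    have hconj : ∀ c d, Equiv.swap (g c) (g d) * g = g * Equiv.swap c d := by
      intro c d
      rw [Equiv.swap_mul_eq_mul_swap]
      simp
    -- Antisymmetrising in x, y gives an element alternating in i + 1 pairs, hence zero; conjugating
    -- back by g yields symmetry in a, b.
    let v' := permute g v - permute (Equiv.swap x y) (permute g v)
    have hgalt : PairAlternating s i (permute g v) := by
      intro j hj
      have hjl : j ≠ l := fun h => by simp [h, l] at hj
      have h1 : g (s (Sum.inl j)) = s (Sum.inl j) :=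
        hfix _ (by simpa [hx] using hjl) (by simp [hy]) (ha j hj).1.symm (hb j hj).1.symm
      have h2 : g (s (Sum.inr j)) = s (Sum.inr j) :=
        hfix _ (by simp [hx]) (by simpa [hy] using hjl) (ha j hj).2.symm (hb j hj).2.symm
      have h3 := hconj (s (Sum.inl j)) (s (Sum.inr j))
      rw [h1, h2] at h3
      rw [← permute_mul, h3, permute_mul, halt j hj, permute_neg]
    have hv' : v' = 0 := by
      by_contra hne
      refine hmax (i + 1) (Nat.lt_succ_self i) hik
        ⟨v', sub_mem (hW _ _ hv) (hW _ _ (hW _ _ hv)), hne, fun j hj => ?_⟩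
      rcases Nat.lt_succ_iff_lt_or_eq.1 hj with hj | hj
      · have hjl : j ≠ l := fun h => by simp [h, l] at hj
        have hcomm : Equiv.swap (s (Sum.inl j)) (s (Sum.inr j)) * Equiv.swap x y =
            Equiv.swap x y * Equiv.swap (s (Sum.inl j)) (s (Sum.inr j)) := by
          rw [Equiv.mul_swap_eq_swap_mul,
            Equiv.swap_apply_of_ne_of_ne (by simpa [hx] using hjl.symm) (by simp [hx]),
            Equiv.swap_apply_of_ne_of_ne (by simp [hy]) (by simpa [hy] using hjl.symm)]
        simp only [v']
        rw [permute_sub, ← permute_mul _ (Equiv.swap x y), hcomm, permute_mul (Equiv.swap x y),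
          hgalt j hj, permute_neg]
        abel
      · have hjl : j = l := Fin.ext hj
        subst hjl
        simp only [v']
        rw [permute_sub, ← permute_mul _ (Equiv.swap x y), Equiv.swap_mul_self, permute_one]
        abel
    have h := sub_eq_zero.1 hv'
    have hswap : Equiv.swap x y * g = g * Equiv.swap a b := by
      rw [← hconj, hga, hgb]
    rw [← permute_mul, hswap, permute_mul g] at h
    exact (permute_injective g h).symm
  have hcv := eq_smul_phi_of_symmetries s ⟨i, Nat.lt_succ_of_le hle⟩ halt hsym
  have hc : v (baseEdge s) ≠ 0 := fun h => hv0 (by rw [hcv, h, zero_smul])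
  rw [hcv] at hv
  exact (Submodule.smul_mem_iff _ hc).1 hv

/-! ### Invariant subspaces and orthogonality of the V_i -/

variable [Fintype V]

/-- An invariant subspace not orthogonal to `φ_i` contains `φ_i`. -/
theorem phi_mem_of_inter_ne_zero {W : Submodule ℝ (WeightedHypergraph V k)}
    (hW : PermInvariant W) (i : Fin (k + 1)) {u : WeightedHypergraph V k} (hu : u ∈ W)
    (hne : inter u (phi s i) ≠ 0) : phi s i ∈ W := by
  obtain ⟨w, hw, p, hp, hwp⟩ := exists_mem_add_orthogonal W (phi s i)
  -- Uniqueness of the decomposition transfers the symmetries of φ_i to its projection w, which is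
  -- therefore a multiple of φ_i.
  have huniq : ∀ w₁ ∈ W, ∀ w₂ ∈ W, ∀ p₁ p₂ : WeightedHypergraph V k,
      (∀ v ∈ W, inter v p₁ = 0) → (∀ v ∈ W, inter v p₂ = 0) → w₁ + p₁ = w₂ + p₂ → w₁ = w₂ := by
    intro w₁ h₁ w₂ h₂ p₁ p₂ hp₁ hp₂ h
    rw [← sub_eq_zero, ← inter_self_eq_zero]
    have hd := sub_mem h₁ h₂
    have h3 : p₂ = (w₁ - w₂) + p₁ := by rw [sub_add_eq_add_sub, h]; abel
    have h4 := hp₂ _ hd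
    rw [h3, inter_comm, inter_add_left, inter_comm p₁, hp₁ _ hd, add_zero] at h4
    exact h4
  have hpinv : ∀ π : Equiv.Perm V, ∀ v ∈ W, inter v (permute π p) = 0 := by
    intro π v hv
    rw [inter_comm, inter_permute_left, inter_comm]
    exact hp _ (hW _ _ hv)
  have halt : PairAlternating s i w := by
    intro j hj
    have h := pairAlternating_phi s i j hj
    rw [hwp, permute_add, neg_add] at h
    refine huniq _ (hW _ _ hw) _ (neg_mem hw) _ _ (hpinv _) (fun v hv => ?_) h
    rw [inter_comm, inter_neg_left, inter_comm, hp v hv, neg_zero]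
  have hsym : OutsideSymmetric s i w := by
    intro a b ha hb
    have h := outsideSymmetric_phi s i a b ha hb
    rw [hwp, permute_add] at h
    exact huniq _ (hW _ _ hw) _ hw _ _ (hpinv _) hp h
  have hcw := eq_smul_phi_of_symmetries s i halt fun _ => hsym
  have hc : w (baseEdge s) ≠ 0 := by
    intro h0
    apply hne
    rw [h0, zero_smul] at hcw
    rw [hwp, hcw, zero_add]
    exact hp u hu
  rw [hcw] at hw
  exact (Submodule.smul_mem_iff _ hc).1 hw

/-- A product of fewer than `j` vertex indicators and differences of vertex indicators is
orthogonal to `φ_j`. -/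
theorem sum_prod_indicator_mul_phi_eq_zero (j : Fin (k + 1)) (a b : Fin k → V) (S : Finset (Fin k))
    (B : Finset V) (hcard : S.card + B.card < j) :
    ∑ A : Set.powersetCard V k, (if B ⊆ (A : Finset V) then (1 : ℝ) else 0) *
      (∏ l ∈ S, (vertexIndicator (a l) A - vertexIndicator (b l) A)) * phi s j A = 0 := by
  induction S using Finset.induction_on generalizing B with
  | empty =>
    -- Fewer than j vertices miss one of the j pairs; its swap fixes the indicator of B but negates
    -- φ_j.
    obtain ⟨l, hl, hlB⟩ : ∃ l : Fin k, (l : ℕ) < j ∧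
        s (Sum.inl l) ∉ B ∧ s (Sum.inr l) ∉ B := by
      by_contra! hcon
      have hjk : (j : ℕ) ≤ k := Nat.lt_succ_iff.1 j.2
      let f : Fin j → V := fun l =>
        if s (Sum.inl (Fin.castLE hjk l)) ∈ B then s (Sum.inl (Fin.castLE hjk l))
        else s (Sum.inr (Fin.castLE hjk l))
      have hf : Function.Injective f := by
        intro l m h
        simp only [f] at h
        split_ifs at h <;> simp at h <;> exact h
      have hfB : ∀ l, f l ∈ B := by
        intro l
        simp only [f]
        split_ifs with h
        · exact h
        · exact hcon (Fin.castLE hjk l) l.2 h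
      have := Finset.card_le_card_of_injOn (s := Finset.univ) f (fun l _ => hfB l) hf.injOn
      simp at this hcard
      omega
    let τ := Equiv.swap (s (Sum.inl l)) (s (Sum.inr l))
    let w : WeightedHypergraph V k := fun A => if B ⊆ (A : Finset V) then (1 : ℝ) else 0
    have hw : permute τ w = w := by
      funext A
      have : B ⊆ ((τ⁻¹ • A : Set.powersetCard V k) : Finset V) ↔ B ⊆ (A : Finset V) := by
        refine forall₂_congr fun c hc => ?_
        have h1 : c ≠ s (Sum.inl l) := fun h => hlB.1 (h ▸ hc)
        have h2 : c ≠ s (Sum.inr l) := fun h => hlB.2 (h ▸ hc)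
        rw [mem_inv_smul_iff, Equiv.swap_apply_of_ne_of_ne h1 h2]
      simp only [permute, w, this]
    have h : inter w (phi s j) = 0 := by
      have h1 := inter_permute_permute τ w (phi s j)
      rw [hw, pairAlternating_phi s j l hl, inter_comm, inter_neg_left, inter_comm] at h1
      linarith
    simpa [inter, w] using h
  | insert l S hl ih =>
    rw [Finset.card_insert_of_notMem hl] at hcard
    -- Expanding one difference moves an index from S to at most one new vertex of B, so the bound
    -- survives.
    have h1 := ih (insert (a l) B) (by have := Finset.card_insert_le (a l) B; omega)
    have h2 := ih (insert (b l) B) (by have := Finset.card_insert_le (b l) B; omega)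
    have h3 := congrArg₂ (· - ·) h1 h2
    simp only [sub_zero, ← Finset.sum_sub_distrib] at h3
    refine Eq.trans ?_ h3
    refine Finset.sum_congr rfl fun A _ => ?_
    have hins : ∀ c : V, (if insert c B ⊆ (A : Finset V) then (1 : ℝ) else 0) =
        vertexIndicator c A * if B ⊆ (A : Finset V) then (1 : ℝ) else 0 := by
      intro c
      by_cases hc : c ∈ (A : Finset V) <;> simp [vertexIndicator, Finset.insert_subset_iff, hc]
    rw [Finset.prod_insert hl, hins, hins]
    ring

theorem inter_permute_phi_phi_of_lt {i j : Fin (k + 1)} (hij : i < j) (π : Equiv.Perm V) :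
    inter (permute π (phi s i)) (phi s j) = 0 := by
  have hcard : (Finset.univ.filter fun l : Fin k => (l : ℕ) < i).card = i := by
    rw [Fin.card_filter_val_lt]
    exact min_eq_right (Nat.lt_succ_iff.1 i.2)
  have := sum_prod_indicator_mul_phi_eq_zero s j (fun l => π (s (Sum.inl l)))
    (fun l => π (s (Sum.inr l))) (Finset.univ.filter fun l : Fin k => (l : ℕ) < i) ∅
    (by simpa [hcard] using hij)
  rw [← this]
  refine Finset.sum_congr rfl fun A _ => ?_
  simp [permute, phi_apply_eq_prod s i, vertexIndicator_inv_smul]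

theorem inter_permute_phi_phi {i j : Fin (k + 1)} (hij : i ≠ j) (π : Equiv.Perm V) :
    inter (permute π (phi s i)) (phi s j) = 0 := by
  rcases lt_or_gt_of_ne hij with h | h
  · exact inter_permute_phi_phi_of_lt s h π
  · rw [inter_permute_left, inter_comm]
    exact inter_permute_phi_phi_of_lt s h _

theorem inter_eq_zero_of_mem_phiSpan {i j : Fin (k + 1)} (hij : i ≠ j)
    {w u : WeightedHypergraph V k} (hw : w ∈ phiSpan s i) (hu : u ∈ phiSpan s j) :
    inter w u = 0 :=
  inter_eq_zero_of_mem_orbitSpan_of_mem_orbitSpan (inter_permute_phi_phi s hij) hw hu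

theorem phi_mem_phiSpan (i : Fin (k + 1)) : phi s i ∈ phiSpan s i := self_mem_orbitSpan _

theorem inter_phi_zero (w : WeightedHypergraph V k) : inter w (phi s 0) = w.total := by
  simp [phi_zero, inter, total]

/-- A weighting whose orbit spans no `φ_j` with `j ≠ i` lies in `V_i`. -/
theorem mem_phiSpan_of_phi_notMem {i : Fin (k + 1)} {u : WeightedHypergraph V k}
    (h : ∀ j ≠ i, phi s j ∉ orbitSpan u) : u ∈ phiSpan s i := by
  obtain ⟨w, hw, p, hp, rfl⟩ := exists_mem_add_orthogonal (phiSpan s i) u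
  suffices p = 0 by simpa [this] using hw
  by_contra hp0
  obtain ⟨j, hj⟩ := exists_phi_mem s (permInvariant_orbitSpan p) (self_mem_orbitSpan p) hp0
  obtain ⟨π, hπ⟩ : ∃ π : Equiv.Perm V, inter (permute π p) (phi s j) ≠ 0 := by
    by_contra! hcon
    exact phi_ne_zero s j (inter_self_eq_zero.1 (inter_eq_zero_of_mem_orbitSpan hcon hj))
  -- The residue p is orthogonal to V_i, which excludes j = i. For j ≠ i the V_i-component is
  -- invisible to φ_j, so the orbit of w + p also detects φ_j.
  by_cases hji : j = i
  · subst hji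
    apply hπ
    rw [inter_permute_left, inter_comm]
    exact hp _ (permInvariant_orbitSpan _ _ _ (phi_mem_phiSpan s j))
  · refine h j hji (phi_mem_of_inter_ne_zero s (permInvariant_orbitSpan _) j
      (permute_mem_orbitSpan π (w + p)) ?_)
    rwa [permute_add, inter_add_left, inter_eq_zero_of_mem_phiSpan s (Ne.symm hji)
      (permInvariant_orbitSpan _ π _ hw) (phi_mem_phiSpan s j), zero_add]

end Phi

/-! ### Discrepancy and the main theorem -/

theorem disc_eq_zero_iff [Fintype V] {w u : WeightedHypergraph V k} (hw : w.total = 0) :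
    disc w u = 0 ↔ ∀ π : Equiv.Perm V, inter (permute π w) u = 0 := by
  have hd : w.density = 0 := by simp [density, hw]
  simp only [disc, hd, zero_mul, sub_zero]
  constructor
  · intro h π
    have := Finset.le_sup' (fun π : Equiv.Perm V => |inter (permute π w) u|) (Finset.mem_univ π)
    rw [h] at this
    exact abs_nonpos_iff.1 this
  · intro h
    simp [h]

end WeightedHypergraph

open WeightedHypergraph

theorem mainTheorem8 {V : Type*} [Fintype V] [DecidableEq V] (k : ℕ) (hk : 1 ≤ k)
    (hn : 2 * k ≤ Fintype.card V) (s : Fin k ⊕ Fin k ↪ V)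
    (u : Fin k → WeightedHypergraph V k) (hu : ∀ i, u i ≠ 0) :
    ((∀ i, (u i).total = 0) ∧ ∀ i j, i < j → WeightedHypergraph.disc (u i) (u j) = 0) ↔
      ∃ σ : Equiv.Perm (Fin k), ∀ i : Fin k,
        u (σ i) ∈ WeightedHypergraph.phiSpan s i.succ := by
  constructor
  · rintro ⟨htot, hdisc⟩
    have hzero : ∀ m, phi s 0 ∉ orbitSpan (u m) := by
      intro m hm
      refine phi_ne_zero s 0 (inter_self_eq_zero.1 (inter_eq_zero_of_mem_orbitSpan (fun π => ?_) hm))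
      rw [inter_permute_left, phi_zero]
      change inter (u m) 1 = 0
      rw [← phi_zero s, inter_phi_zero, htot]
    have hdisj_lt : ∀ m m', m < m' → ∀ i, phi s i ∈ orbitSpan (u m) →
        phi s i ∉ orbitSpan (u m') := fun m m' hlt i h h' =>
      phi_ne_zero s i (inter_self_eq_zero.1 (inter_eq_zero_of_mem_orbitSpan_of_mem_orbitSpan
        ((disc_eq_zero_iff (htot m)).1 (hdisc m m' hlt)) h h'))
    have hdisj : ∀ m m' i, phi s i ∈ orbitSpan (u m) → phi s i ∈ orbitSpan (u m') → m = m' := by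
      intro m m' i h h'
      rcases lt_trichotomy m m' with hlt | heq | hlt
      · exact absurd h' (hdisj_lt m m' hlt i h)
      · exact heq
      · exact absurd h (hdisj_lt m' m hlt i h')
    have hex : ∀ m, ∃ i : Fin k, phi s i.succ ∈ orbitSpan (u m) := by
      intro m
      obtain ⟨i, hi⟩ := exists_phi_mem s (permInvariant_orbitSpan (u m))
        (self_mem_orbitSpan (u m)) (hu m)
      have hi0 : i ≠ 0 := fun h => hzero m (h ▸ hi)
      obtain ⟨j, rfl⟩ := Fin.exists_succ_eq.2 hi0
      exact ⟨j, hi⟩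
    choose f hf using hex
    have hinj : Function.Injective f := fun m m' h => hdisj m m' _ (hf m) (h ▸ hf m')
    -- An injection of k weightings into k indices is onto, so every φ_l with l ≥ 1 is already
    -- claimed by one weighting.
    let F : Equiv.Perm (Fin k) := Equiv.ofBijective f (Finite.injective_iff_bijective.1 hinj)
    refine ⟨F.symm, fun i => ?_⟩
    refine mem_phiSpan_of_phi_notMem s fun j hj hmem => ?_
    have hj0 : j ≠ 0 := fun h => hzero _ (h ▸ hmem)
    obtain ⟨l, rfl⟩ := Fin.exists_succ_eq.2 hj0
    have hl : phi s l.succ ∈ orbitSpan (u (F.symm l)) := by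
      have := hf (F.symm l)
      rwa [show f (F.symm l) = l from F.apply_symm_apply l] at this
    exact hj (congrArg Fin.succ (F.symm.injective (hdisj _ _ _ hl hmem)))
  · rintro ⟨σ, hσ⟩
    have hmem : ∀ m, u m ∈ phiSpan s (σ.symm m).succ := fun m => by
      simpa using hσ (σ.symm m)
    have htot : ∀ m, (u m).total = 0 := fun m => by
      rw [← inter_phi_zero s]
      exact inter_eq_zero_of_mem_phiSpan s (Fin.succ_ne_zero _) (hmem m) (phi_mem_phiSpan s 0)
    refine ⟨htot, fun i j hij => (disc_eq_zero_iff (htot i)).2 fun π => ?_⟩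
    refine inter_eq_zero_of_mem_phiSpan s (fun h => hij.ne ?_)
      (permInvariant_orbitSpan _ π _ (hmem i)) (hmem j)
    exact σ.symm.injective (Fin.succ_injective _ h)
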